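/- Let $\varepsilon>0$ and let $K$ be the Bessel kernel on $[-1,1]\times[-1,1]$, $$K(x,y)=\mathcal I_0\big(2\sqrt{\varepsilon xy}\,\big)=\sum_{k=0}^\infty \alpha_k^{-1}x^ky^k,\qquad \alpha_k=\varepsilon^{-k}(k!)^2,$$ where $\mathcal I_0(z)=\sum_{k\ge 0}(z^2/4)^k/(k!)^2$ is the modified Bessel function of the first kind of order zero (an even entire function, so that the choice of the square root, also for $xy<0$, is immaterial). Let $H(K)$ be the reproducing kernel Hilbert space of $K$, with norm $\|\cdot\|_K$. For pairwise distinct points $x_1,\dots,x_n\in[-1,1]$ and Lebesgue measurable functions $\psi_1,\dots,\psi_n\colon[-1,1]\to\mathbb R$ consider the linear approximation $$A_nf=\sum_{k=1}^n f(x_k)\psi_k \qquad (\ast)$$ and put $$e_\infty(A_n)=\sup_{0\ne f\in H(K)}\frac{\sup_{x\in[-1,1]}|f(x)-(A_nf)(x)|}{\|f\|_K}\in[0,\infty],\qquad e_\infty^{\min}(n)=\inf_{A_n}e_\infty(A_n),$$ the infimum being over all $A_n$ of the form $(\ast)$. For $\lambda>0$ let $$c_L(\lambda)=\frac{e^{-\frac32\lambda+2\sqrt\lambda}}{2\sqrt\pi\,\lambda^{1/4}}\Big(3+\sqrt{\tfrac{\pi}{e}}+\frac{2}{\sqrt\pi\,\lambda^{1/4}}+\frac{7}{16\sqrt\lambda}+\sqrt\lambda(2+\lambda)\Big),$$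 $$m_L(\lambda)=\max\Big\{5\lambda,\ \lambda\big(1+\tfrac\lambda2\big)^2,\ \tfrac9\lambda\Big\},$$ and let $$c_1=\sqrt{\frac{2}{1+\varepsilon}}\;e^{-\frac1{32}\varepsilon^2},\qquad c_2=2\sqrt{c_L(\varepsilon)}.$$ Then for every integer $n\ge m_L(\varepsilon)$ $$c_1\Big(\frac{\varepsilon^{1/2}}2\Big)^n(n!)^{-1}\le e_\infty^{\min}(n)\le c_2\,n^{-1/8}e^{\sqrt{\varepsilon n}}\Big(\frac{\varepsilon^{1/2}}2\Big)^n(n!)^{-1},$$ and for any pairwise distinct $x_1,\dots,x_n\in[-1,1]$ there is a linear approximation $A_n$ of the form $(\ast)$ that uses these points such that $$c_1\Big(\frac{\varepsilon^{1/2}}2\Big)^n(n!)^{-1}\le e_\infty(A_n)\le \frac{c_2}2\,n^{-1/8}e^{\sqrt{\varepsilon n}}\,(2\varepsilon^{1/2})^n(n!)^{-1}.$$ -/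

import Mathlib

open scoped ENNReal

/-- The interval `[-1, 1]`, on which all functions live. -/
abbrev UnitSym : Type := ↥(Set.Icc (-1 : ℝ) 1)

/-- The modified Bessel function of the first kind of order zero,
`I₀(z) = ∑ (z² / 4)ᵏ / (k!)²`. -/
noncomputable def besselI0 (z : ℂ) : ℂ :=
  ∑' k : ℕ, (z ^ 2 / 4) ^ k / ((k.factorial : ℂ) ^ 2)

/-- The Bessel kernel `K(x, y) = I₀(2 √(ε x y))` on `[-1, 1]`. The square root is the complex one,
as `x y` may be negative; `I₀` is even, so that the choice of the branch is immaterial, and the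
value is real (see `besselKernel_eq_tsum`). -/
noncomputable def besselKernel (ε : ℝ) (x y : UnitSym) : ℝ :=
  (besselI0 (2 * (((ε * x * y : ℝ) : ℂ) ^ (1 / 2 : ℂ)))).re

/-- `H` is the reproducing kernel Hilbert space `H(K)` of the scalar kernel `K` : its reproducing
kernel (an operator on the one-dimensional space `ℝ` for each pair of points) is
multiplication by `K x y`. -/
def HasScalarKernel (H : Type*) {X : Type*} [NormedAddCommGroup H] [InnerProductSpace ℝ H]
    [CompleteSpace H] [RKHS ℝ H X ℝ] (K : X → X → ℝ) : Prop :=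
  ∀ x y : X, RKHS.kernel H x y = K x y • ContinuousLinearMap.id ℝ ℝ

/-- The data of a linear approximation `A f = ∑ₖ f(xₖ) ψₖ` that uses `n` function evaluations:
pairwise distinct points `xₖ ∈ [-1, 1]` and Lebesgue measurable functions `ψₖ : [-1, 1] → ℝ`. -/
structure LinearApprox (n : ℕ) where
  point : Fin n → UnitSym
  point_injective : Function.Injective point
  weight : Fin n → UnitSym → ℝ
  weight_measurable : ∀ k,
    MeasureTheory.NullMeasurable (weight k) (MeasureTheory.volume.comap (Subtype.val : UnitSym → ℝ))

/-- The function `A f = ∑ₖ f(xₖ) ψₖ`. -/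
noncomputable def LinearApprox.apply {n : ℕ} (A : LinearApprox n) (f : UnitSym → ℝ) :
    UnitSym → ℝ :=
  fun x => ∑ k, f (A.point k) * A.weight k x

/-- The uniform norm `sup_{x ∈ [-1, 1]} |g x|`, possibly infinite. -/
noncomputable def uniformNorm (g : UnitSym → ℝ) : ℝ≥0∞ :=
  ⨆ x, ENNReal.ofReal |g x|

section Errors

variable (H : Type*) [NormedAddCommGroup H] [InnerProductSpace ℝ H] [RKHS ℝ H UnitSym ℝ]

/-- The worst-case error `e_∞(A) = sup_{0 ≠ f ∈ H} ‖f - A f‖_∞ / ‖f‖_H`, possibly infinite. -/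
noncomputable def worstCaseError {n : ℕ} (A : LinearApprox n) : ℝ≥0∞ :=
  ⨆ (f : H) (_ : f ≠ 0), uniformNorm (fun x => f x - A.apply f x) / ENNReal.ofReal ‖f‖

/-- The `n`th minimal error `e_∞^min(n) = inf_A e_∞(A)`. -/
noncomputable def minimalError (n : ℕ) : ℝ≥0∞ :=
  ⨅ A : LinearApprox n, worstCaseError H A

end Errors

/-- The function `c_L`. -/
noncomputable def cL (l : ℝ) : ℝ :=
  Real.exp (-(3 / 2) * l + 2 * √l) / (2 * √Real.pi * l ^ (1 / 4 : ℝ)) *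
    (3 + √(Real.pi / Real.exp 1) + 2 / (√Real.pi * l ^ (1 / 4 : ℝ)) + 7 / (16 * √l)
      + √l * (2 + l))

/-- The function `m_L`. -/
noncomputable def mL (l : ℝ) : ℝ :=
  max (max (5 * l) (l * (1 + l / 2) ^ 2)) (9 / l)

/-- The Bessel kernel is the power series kernel `∑ αₖ⁻¹ xᵏ yᵏ` with `αₖ = ε⁻ᵏ (k!)²`. -/
theorem besselKernel_eq_tsum (ε : ℝ) (x y : UnitSym) :
    besselKernel ε x y =
      ∑' k : ℕ, (ε⁻¹ ^ k * (k.factorial : ℝ) ^ 2)⁻¹ * (x : ℝ) ^ k * (y : ℝ) ^ k := by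
  have h : besselI0 (2 * (((ε * x * y : ℝ) : ℂ) ^ (1 / 2 : ℂ))) =
      ((∑' k : ℕ, (ε⁻¹ ^ k * (k.factorial : ℝ) ^ 2)⁻¹ * (x : ℝ) ^ k * (y : ℝ) ^ k : ℝ) : ℂ) := by
    rw [besselI0, Complex.ofReal_tsum]
    refine tsum_congr fun k => ?_
    have h2 : ((((ε * x * y : ℝ) : ℂ) ^ (1 / 2 : ℂ))) ^ 2 = ((ε * x * y : ℝ) : ℂ) := by
      simp
    rw [mul_pow, h2]
    push_cast
    rw [mul_inv, inv_pow, inv_inv]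
    ring
  rw [besselKernel, h, Complex.ofReal_re]

theorem summable_bessel (ε : ℝ) (x y : UnitSym) :
    Summable fun k : ℕ => (ε⁻¹ ^ k * (k.factorial : ℝ) ^ 2)⁻¹ * (x : ℝ) ^ k * (y : ℝ) ^ k := by
  refine Summable.of_norm_bounded (g := fun k : ℕ => |ε * x * y| ^ k / (k.factorial : ℝ))
    (Real.summable_pow_div_factorial _) fun k => ?_
  have h1 : (1 : ℝ) ≤ k.factorial := by exact_mod_cast Nat.one_le_iff_ne_zero.2 k.factorial_ne_zero
  have : (ε⁻¹ ^ k * (k.factorial : ℝ) ^ 2)⁻¹ * (x : ℝ) ^ k * (y : ℝ) ^ k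
      = (ε * x * y) ^ k / (k.factorial : ℝ) ^ 2 := by
    rw [mul_inv, inv_pow, inv_inv]; ring
  rw [this, norm_div, norm_pow, norm_pow, Real.norm_eq_abs, Real.norm_natCast]
  gcongr
  nlinarith

/-- The Bessel kernel is positive semidefinite. -/
theorem posSemidef_besselKernel {ε : ℝ} (hε : 0 < ε) :
    (Matrix.of fun x y => besselKernel ε x y • ContinuousLinearMap.id ℝ ℝ :
      Matrix UnitSym UnitSym (ℝ →L[ℝ] ℝ)).PosSemidef := by
  have key := RKHS.posSemidef_tfae (𝕜 := ℝ) (K := (Matrix.of fun x y =>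
    besselKernel ε x y • ContinuousLinearMap.id ℝ ℝ : Matrix UnitSym UnitSym (ℝ →L[ℝ] ℝ)))
  apply (key.out 0 2).mpr
  refine ⟨?_, fun v => ?_⟩
  · ext x y
    have hst : star (ContinuousLinearMap.id ℝ ℝ) = ContinuousLinearMap.id ℝ ℝ :=
      star_one (ℝ →L[ℝ] ℝ)
    simp [hst, besselKernel_eq_tsum, Matrix.conjTranspose_apply, mul_right_comm]
  · have : (v.sum fun x w => v.sum fun x' w' =>
        inner ℝ ((Matrix.of fun x y => besselKernel ε x y • ContinuousLinearMap.id ℝ ℝ :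
          Matrix UnitSym UnitSym (ℝ →L[ℝ] ℝ)) x' x w) w') =
        ∑' k : ℕ, (ε⁻¹ ^ k * (k.factorial : ℝ) ^ 2)⁻¹ * (∑ x ∈ v.support, v x * (x : ℝ) ^ k) ^ 2 := by
      have hs : ∀ k : ℕ, (ε⁻¹ ^ k * (k.factorial : ℝ) ^ 2)⁻¹ *
          (∑ x ∈ v.support, v x * (x : ℝ) ^ k) ^ 2 = ∑ x ∈ v.support, ∑ x' ∈ v.support,
            ((ε⁻¹ ^ k * (k.factorial : ℝ) ^ 2)⁻¹ * (x' : ℝ) ^ k * (x : ℝ) ^ k) * (v x * v x') := by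
        intro k
        rw [sq (∑ x ∈ v.support, v x * (x : ℝ) ^ k), Finset.sum_mul_sum, Finset.mul_sum]
        refine Finset.sum_congr rfl fun x _ => ?_
        rw [Finset.mul_sum]
        exact Finset.sum_congr rfl fun x' _ => by ring
      simp_rw [hs]
      rw [Summable.tsum_finsetSum fun x _ => summable_sum fun x' _ =>
        (summable_bessel ε x' x).mul_right _]
      refine Finset.sum_congr rfl fun x _ => ?_
      rw [Summable.tsum_finsetSum fun x' _ => (summable_bessel ε x' x).mul_right _]
      refine Finset.sum_congr rfl fun x' _ => ?_
      rw [tsum_mul_right, ← besselKernel_eq_tsum]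
      simp
      ring
    rw [this]
    exact tsum_nonneg fun k => by positivity

/-- For each `ε > 0` the reproducing kernel Hilbert space of the Bessel kernel exists. -/
theorem exists_besselRKHS {ε : ℝ} (hε : 0 < ε) :
    ∃ (H : Type) (_ : NormedAddCommGroup H) (_ : InnerProductSpace ℝ H) (_ : CompleteSpace H)
      (_ : RKHS ℝ H UnitSym ℝ), HasScalarKernel H (besselKernel ε) := by
  have : Fact (Matrix.of fun x y => besselKernel ε x y • ContinuousLinearMap.id ℝ ℝ :
      Matrix UnitSym UnitSym (ℝ →L[ℝ] ℝ)).PosSemidef := ⟨posSemidef_besselKernel hε⟩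
  exact ⟨RKHS.OfKernel (Matrix.of fun x y => besselKernel ε x y • ContinuousLinearMap.id ℝ ℝ :
      Matrix UnitSym UnitSym (ℝ →L[ℝ] ℝ)), inferInstance, inferInstance, inferInstance,
      inferInstance, fun x y => by rw [RKHS.OfKernel.kernel_ofKernel]; rfl⟩

/-!
By the reproducing property, the error functional `f ↦ f x - A f x` is the inner product with a
representer `rₓ`, so the worst-case error of `A` is `sup ‖rₓ‖`. Since the kernel is the power series
`∑ wₖ xᵏ yᵏ`, we have `‖rₓ‖² = ∑ wₖ eₖ(x)²`, where `eₖ` is the error of `A` on the monomial `xᵏ`;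
both bounds are therefore about monomials.

For Lagrange interpolation, `eₖ` is the nodal polynomial times the quotient of `xᵏ` by it, and this
quotient is at most `k.choose n` on `[-1, 1]`. As `wⱼ₊ₙ (j + n choose n)² = wⱼ wₙ`, the error is at
most `√(wₙ I₀(2√ε))` times the supremum of the nodal polynomial, which is `2 / 2ⁿ` at the Chebyshev
nodes and at most `2ⁿ` at any nodes.

Conversely, every `A` annihilates the nodal polynomial of its points. Expanding it in monomials,
whose coefficients are at most `n.choose k`, the Cauchy-Schwarz inequality bounds it at `x` by
`√(I₀(2√ε) / wₙ) ‖rₓ‖`, while the supremum of a monic polynomial of degree `n` on `[-1, 1]` is at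
least `2 / 2ⁿ`. The constants come from `I₀(2√ε) ≤ exp (2√ε)` and `I₀(2√ε) ≤ 2 exp (ε / 2)`.
-/

section Interpolation

open Polynomial

theorem X_mul_divByMonic_X_sub_C_mul {R : Type*} [CommRing R] {N : R[X]}
    (hN : N.Monic) (a : R) (p : R[X]) :
    (X * p) /ₘ ((X - C a) * N) = C a * (p /ₘ ((X - C a) * N)) + p /ₘ N := by
  nontriviality R
  have hM : ((X - C a) * N).Monic := (monic_X_sub_C a).mul hN
  have hdeg : ((X - C a) * N).degree = N.degree + 1 := by
    rw [hN.degree_mul, degree_X_sub_C, add_comm]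
  have hlt : (p %ₘ N).degree < N.degree := degree_modByMonic_lt p hN
  refine (div_modByMonic_unique _ ((X - C a) * (p %ₘ N) + C a * (p %ₘ ((X - C a) * N)))
    hM ⟨?_, ?_⟩).1
  · simp only [modByMonic_eq_sub_mul_div]
    ring
  · refine (degree_add_le _ _).trans_lt (max_lt ?_ ?_)
    · rw [hdeg, (monic_X_sub_C a).degree_mul_comm, (monic_X_sub_C a).degree_mul, degree_X_sub_C]
      exact WithBot.add_lt_add_right WithBot.one_ne_bot hlt
    · rw [← smul_eq_C_mul]
      exact (degree_smul_le _ _).trans_lt (degree_modByMonic_lt p hM)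

variable {ι : Type*} {s : Finset ι}

theorem norm_eval_X_pow_divByMonic_nodal_le_choose {R : Type*} [NormedCommRing R] [NormOneClass R]
    {v : ι → R} (hv : ∀ i ∈ s, ‖v i‖ ≤ 1) {x : R} (hx : ‖x‖ ≤ 1) (k : ℕ) :
    ‖(X ^ k /ₘ Lagrange.nodal s v).eval x‖ ≤ k.choose s.card := by
  classical
  have : Nontrivial R := NormOneClass.nontrivial
  induction s using Finset.induction_on generalizing k with
  | empty => simpa using (norm_pow_le x k).trans (pow_le_one₀ (norm_nonneg x) hx)
  | insert a s ha ih =>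
    have ih := ih fun i hi => hv i (Finset.mem_insert_of_mem hi)
    rw [Finset.card_insert_of_notMem ha, Lagrange.nodal_insert_eq_nodal ha]
    induction k with
    | zero =>
      have hM := (monic_X_sub_C (v a)).mul (Lagrange.nodal_monic (s := s) (v := v))
      rw [pow_zero, (divByMonic_eq_zero_iff hM).2]
      · simp
      · rw [(Lagrange.nodal_monic).degree_mul, degree_one, degree_X_sub_C, Lagrange.degree_nodal]
        exact_mod_cast Nat.add_pos_left one_pos _
    | succ k ihk =>
      rw [pow_succ', X_mul_divByMonic_X_sub_C_mul Lagrange.nodal_monic, eval_add, eval_C_mul,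
        Nat.choose_succ_succ', Nat.cast_add, add_comm]
      refine norm_add_le_of_le (ih k) ((norm_mul_le _ _).trans ?_)
      exact (mul_le_of_le_one_left (norm_nonneg _) (hv a (s.mem_insert_self a))).trans ihk

theorem modByMonic_nodal_eq_interpolate {F : Type*} [Field F] [DecidableEq ι] {v : ι → F}
    (hv : Set.InjOn v s) (p : F[X]) :
    p %ₘ Lagrange.nodal s v = Lagrange.interpolate s v fun i => p.eval (v i) := by
  refine Lagrange.eq_interpolate_of_eval_eq _ hv ?_ fun i hi => ?_
  · exact (degree_modByMonic_lt p Lagrange.nodal_monic).trans_eq Lagrange.degree_nodal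
  · simp [modByMonic_eq_sub_mul_div, Lagrange.eval_nodal_at_node hi]

theorem norm_pow_sub_eval_interpolate_pow_le {F : Type*} [NormedField F] [DecidableEq ι]
    {v : ι → F} (hinj : Set.InjOn v s) (hv : ∀ i ∈ s, ‖v i‖ ≤ 1) {x : F} (hx : ‖x‖ ≤ 1) (k : ℕ) :
    ‖x ^ k - (Lagrange.interpolate s v fun i => v i ^ k).eval x‖ ≤
      k.choose s.card * ‖∏ i ∈ s, (x - v i)‖ := by
  have hremainder : x ^ k - (Lagrange.interpolate s v fun i => v i ^ k).eval x =
      (X ^ k /ₘ Lagrange.nodal s v).eval x * ∏ i ∈ s, (x - v i) := by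
    have h := congrArg (eval x) (modByMonic_add_div (X ^ k) (Lagrange.nodal s v))
    simp only [modByMonic_nodal_eq_interpolate hinj, eval_add, eval_mul, Lagrange.eval_nodal,
      eval_pow, eval_X] at h
    linear_combination -h
  rw [hremainder, norm_mul]
  gcongr
  exact norm_eval_X_pow_divByMonic_nodal_le_choose hv hx k

theorem norm_coeff_nodal_le_choose {F : Type*} [NormedField F] {v : ι → F}
    (hv : ∀ i ∈ s, ‖v i‖ ≤ 1) (k : ℕ) : ‖(Lagrange.nodal s v).coeff k‖ ≤ s.card.choose k := by
  have h := coeff_le_of_roots_le (p := Lagrange.nodal s v) (f := RingHom.id F) (B := 1) k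
    Lagrange.nodal_monic ?_ ?_
  · simpa using h
  · simp [Lagrange.nodal_eq, Splits.prod, Splits.X_sub_C]
  · simp only [Polynomial.map_id, mem_roots Lagrange.nodal_ne_zero, IsRoot.def,
      Lagrange.eval_nodal, Finset.prod_eq_zero_iff, sub_eq_zero]
    rintro _ ⟨i, hi, rfl⟩
    exact hv i hi

end Interpolation

section Chebyshev

open Polynomial

theorem exists_two_div_two_pow_le_abs_eval {P : ℝ[X]} (hP : P.Monic) (hdeg : P.natDegree ≠ 0) :
    ∃ x ∈ Set.Icc (-1 : ℝ) 1, 2 / 2 ^ P.natDegree ≤ |P.eval x| := by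
  by_contra! hsmall
  set n := P.natDegree with hn
  have htwo : (2 : ℝ) ^ n = 2 * 2 ^ (n - 1) := (mul_pow_sub_one hdeg 2).symm
  have hlt : ∀ x ∈ Set.Icc (-1 : ℝ) 1, |(C (2 ^ (n - 1)) * P).eval x| < 1 := fun x hx => by
    have h := hsmall x hx
    rw [htwo, lt_div_iff₀ (by positivity)] at h
    rw [eval_C_mul, abs_mul, abs_of_pos (by positivity)]
    linarith
  have hcoeff : (C (2 ^ (n - 1)) * P).coeff n = 2 ^ (n - 1) := by
    rw [coeff_C_mul, hn, hP.coeff_natDegree, mul_one]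
  have hT := (Chebyshev.coeff_eq_iff_of_forall_abs_le_one
    (degree_le_of_natDegree_le (natDegree_C_mul_le _ _)) fun x hx => (hlt x hx).le).1 hcoeff
  have hone := hlt 1 (by simp)
  rw [hT, Chebyshev.T_eval_one, abs_one] at hone
  exact hone.false

theorem exists_chebyshev_nodes {n : ℕ} (hn : n ≠ 0) :
    ∃ v : Fin n → UnitSym, Function.Injective v ∧
      ∀ x : UnitSym, |∏ i, ((x : ℝ) - v i)| ≤ 2 / 2 ^ n := by
  let node : ℕ → ℝ := fun k => Real.cos ((2 * k + 1) * Real.pi / (2 * n))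
  have hinj : Set.InjOn node (Finset.range n) :=
    (Finset.range n).nodup_map_iff_injOn.1 (Chebyshev.roots_T_real_nodup n)
  have hroots : (Chebyshev.T ℝ n).roots = (Finset.range n).val.map node := by
    rw [Chebyshev.roots_T_real, Finset.image_val_of_injOn hinj]
  have hT : C (2 ^ (n - 1)) * ∏ k ∈ Finset.range n, (X - C (node k)) = Chebyshev.T ℝ n := by
    have h := C_leadingCoeff_mul_prod_multiset_X_sub_C (p := Chebyshev.T ℝ n) (by simp [hroots])
    rwa [hroots, Multiset.map_map, Chebyshev.leadingCoeff_T, Int.natAbs_natCast] at h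
  refine ⟨fun i => ⟨node i, Real.cos_mem_Icc _⟩, fun i j hij => ?_, fun x => ?_⟩
  · exact Fin.ext (hinj (by simp) (by simp) (congrArg Subtype.val hij))
  · have hx := Chebyshev.abs_eval_T_real_le_one n (abs_le.2 x.2)
    rw [← hT, eval_C_mul, eval_prod, abs_mul, abs_of_pos (by positivity)] at hx
    simp only [eval_sub, eval_X, eval_C, Finset.prod_range] at hx
    rw [le_div_iff₀ (by positivity), ← mul_pow_sub_one hn]
    linarith

end Chebyshev

section ReproducingKernel

variable {X : Type*} {H : Type*} [NormedAddCommGroup H] [InnerProductSpace ℝ H] [CompleteSpace H]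

theorem HasScalarKernel.inner_kerFun_one [RKHS ℝ H X ℝ] {K : X → X → ℝ}
    (hK : HasScalarKernel H K) (x y : X) :
    inner ℝ (RKHS.kerFun H x (1 : ℝ)) (RKHS.kerFun H y (1 : ℝ)) = K x y := by
  rw [RKHS.kerFun_inner, RKHS.kerFun_apply, hK x y]
  simp

theorem HasScalarKernel.hasSum_norm_sum_smul_kerFun_sq [RKHS ℝ H X ℝ] {K : X → X → ℝ}
    (hK : HasScalarKernel H K) {κ ι : Type*} {w : κ → ℝ} {φ : κ → X → ℝ}
    (hφ : ∀ x y, HasSum (fun k => w k * φ k x * φ k y) (K x y))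
    (s : Finset ι) (c : ι → ℝ) (p : ι → X) :
    HasSum (fun k => w k * (∑ i ∈ s, c i * φ k (p i)) ^ 2)
      (‖∑ i ∈ s, c i • RKHS.kerFun H (p i) (1 : ℝ)‖ ^ 2) := by
  have hnorm : ‖∑ i ∈ s, c i • RKHS.kerFun H (p i) (1 : ℝ)‖ ^ 2 =
      ∑ i ∈ s, ∑ j ∈ s, c j * c i * K (p i) (p j) := by
    rw [← real_inner_self_eq_norm_sq, sum_inner]
    simp only [inner_sum, real_inner_smul_left, real_inner_smul_right, hK.inner_kerFun_one,
      mul_assoc]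
  rw [hnorm]
  refine (hasSum_sum fun i _ => hasSum_sum fun j _ =>
    (hφ (p i) (p j)).mul_left (c j * c i)).congr_fun fun k => ?_
  rw [sq, Finset.sum_mul_sum, Finset.mul_sum]
  refine Finset.sum_congr rfl fun i _ => ?_
  rw [Finset.mul_sum]
  exact Finset.sum_congr rfl fun j _ => by ring

variable [RKHS ℝ H UnitSym ℝ] {n : ℕ}

variable (H) in
/-- The Riesz representer of the error functional `f ↦ f x - A f x`. -/
noncomputable def LinearApprox.errorRepresenter (A : LinearApprox n) (x : UnitSym) : H :=
  RKHS.kerFun H x (1 : ℝ) - ∑ i, A.weight i x • RKHS.kerFun H (A.point i) (1 : ℝ)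

theorem LinearApprox.inner_errorRepresenter (A : LinearApprox n) (x : UnitSym) (f : H) :
    inner ℝ (A.errorRepresenter H x) f = f x - A.apply f x := by
  simp [errorRepresenter, LinearApprox.apply, inner_sub_left, sum_inner, real_inner_smul_left,
    RKHS.kerFun_inner, mul_comm]

theorem LinearApprox.abs_sub_apply_le (A : LinearApprox n) (x : UnitSym) (f : H) :
    |f x - A.apply f x| ≤ ‖A.errorRepresenter H x‖ * ‖f‖ :=
  A.inner_errorRepresenter x f ▸ abs_real_inner_le_norm _ _

theorem LinearApprox.hasSum_norm_errorRepresenter_sq {K : UnitSym → UnitSym → ℝ}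
    (hK : HasScalarKernel H K) {κ : Type*} {w : κ → ℝ} {φ : κ → UnitSym → ℝ}
    (hφ : ∀ x y, HasSum (fun k => w k * φ k x * φ k y) (K x y))
    (A : LinearApprox n) (x : UnitSym) :
    HasSum (fun k => w k * (φ k x - A.apply (φ k) x) ^ 2) (‖A.errorRepresenter H x‖ ^ 2) := by
  have h := hK.hasSum_norm_sum_smul_kerFun_sq hφ Finset.univ
    (fun i : Option (Fin n) => i.elim 1 fun i => -A.weight i x)
    (fun i => i.elim x A.point)
  simpa [Fintype.sum_option, ← sub_eq_add_neg, errorRepresenter, LinearApprox.apply,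
    mul_comm (A.weight _ _)] using h

theorem worstCaseError_eq_iSup_norm_errorRepresenter (A : LinearApprox n) :
    worstCaseError H A = ⨆ x, ENNReal.ofReal ‖A.errorRepresenter H x‖ := by
  refine le_antisymm (iSup₂_le fun f _ => ENNReal.div_le_of_le_mul (iSup_le fun x => ?_))
    (iSup_le fun x => ?_)
  · calc ENNReal.ofReal |f x - A.apply f x|
        ≤ ENNReal.ofReal ‖A.errorRepresenter H x‖ * ENNReal.ofReal ‖f‖ := by
          rw [← ENNReal.ofReal_mul (norm_nonneg _)]
          exact ENNReal.ofReal_le_ofReal (A.abs_sub_apply_le x f)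
      _ ≤ _ := by
          gcongr
          exact le_iSup (fun y => ENNReal.ofReal ‖A.errorRepresenter H y‖) x
  · rcases eq_or_ne (A.errorRepresenter H x) 0 with hzero | hne
    · simp [hzero]
    · refine le_iSup₂_of_le (A.errorRepresenter H x) hne ?_
      rw [ENNReal.le_div_iff_mul_le (.inl (by simpa using hne)) (.inl ENNReal.ofReal_ne_top),
        ← ENNReal.ofReal_mul (norm_nonneg _), ← real_inner_self_eq_norm_mul_norm,
        A.inner_errorRepresenter]
      exact le_iSup_of_le x (ENNReal.ofReal_le_ofReal (le_abs_self _))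

end ReproducingKernel

section PowerSeriesKernel

variable {H : Type*} [NormedAddCommGroup H] [InnerProductSpace ℝ H] [CompleteSpace H]
  [RKHS ℝ H UnitSym ℝ] {K : UnitSym → UnitSym → ℝ} {w : ℕ → ℝ} {n : ℕ}

/-- `K` is the power series kernel `∑ wₖ xᵏ yᵏ`; the weights `wₖ` are the `αₖ⁻¹` of the paper. -/
def IsPowerSeriesKernel (K : UnitSym → UnitSym → ℝ) (w : ℕ → ℝ) : Prop :=
  ∀ x y : UnitSym, HasSum (fun k => w k * (x : ℝ) ^ k * (y : ℝ) ^ k) (K x y)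

/-- The approximation of a function by its Lagrange interpolation polynomial at the nodes `v`. -/
noncomputable def lagrangeApprox (v : Fin n → UnitSym) (hv : Function.Injective v) :
    LinearApprox n where
  point := v
  point_injective := hv
  weight i x := (Lagrange.basis Finset.univ (fun j => (v j : ℝ)) i).eval (x : ℝ)
  weight_measurable i := by
    have hcont : Continuous fun x : UnitSym =>
      (Lagrange.basis Finset.univ (fun j => (v j : ℝ)) i).eval (x : ℝ) := by fun_prop
    exact hcont.measurable.nullMeasurable

theorem abs_pow_sub_lagrangeApprox_apply_pow_le (v : Fin n → UnitSym) (hv : Function.Injective v)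
    (k : ℕ) (x : UnitSym) :
    |(x : ℝ) ^ k - (lagrangeApprox v hv).apply (fun y => (y : ℝ) ^ k) x| ≤
      k.choose n * |∏ i, ((x : ℝ) - v i)| := by
  have h := norm_pow_sub_eval_interpolate_pow_le (s := Finset.univ) (v := fun i => (v i : ℝ))
    (Subtype.val_injective.comp hv).injOn (fun i _ => abs_le.2 (v i).2) (abs_le.2 x.2) k
  simpa [LinearApprox.apply, lagrangeApprox, Lagrange.interpolate_apply,
    Polynomial.eval_finsetSum, Finset.abs_prod] using h

theorem worstCaseError_lagrangeApprox_le (hK : HasScalarKernel H K) (hw : IsPowerSeriesKernel K w)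
    (hpos : ∀ k, 0 ≤ w k) {S : ℝ} (hS : HasSum (fun k => w k * (k.choose n : ℝ) ^ 2) S)
    (v : Fin n → UnitSym) (hv : Function.Injective v) {M : ℝ}
    (hM : ∀ x : UnitSym, |∏ i, ((x : ℝ) - v i)| ≤ M) :
    worstCaseError H (lagrangeApprox v hv) ≤ ENNReal.ofReal (M * √S) := by
  rw [worstCaseError_eq_iSup_norm_errorRepresenter]
  refine iSup_le fun x => ENNReal.ofReal_le_ofReal ?_
  have hM0 : 0 ≤ M := (abs_nonneg _).trans (hM x)
  rw [← Real.sqrt_sq hM0, ← Real.sqrt_mul (sq_nonneg M), mul_comm]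
  refine Real.le_sqrt_of_sq_le (hasSum_le (fun k => ?_)
    ((lagrangeApprox v hv).hasSum_norm_errorRepresenter_sq hK hw x) (hS.mul_right (M ^ 2)))
  rw [mul_assoc, ← mul_pow, ← sq_abs (_ - _)]
  have := hpos k
  gcongr
  refine (abs_pow_sub_lagrangeApprox_apply_pow_le v hv k x).trans ?_
  gcongr
  exact hM x

theorem LinearApprox.sum_coeff_mul_pow_sub_apply_pow (A : LinearApprox n) (P : Polynomial ℝ)
    (x : UnitSym) :
    ∑ k ∈ Finset.range (P.natDegree + 1),
        P.coeff k * ((x : ℝ) ^ k - A.apply (fun y => (y : ℝ) ^ k) x) =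
      P.eval (x : ℝ) - A.apply (fun y => P.eval (y : ℝ)) x := by
  simp only [LinearApprox.apply, Polynomial.eval_eq_sum_range, mul_sub, Finset.sum_sub_distrib,
    Finset.mul_sum, Finset.sum_mul, mul_assoc]
  rw [Finset.sum_comm]

theorem abs_eval_le_of_eval_point_eq_zero (hK : HasScalarKernel H K)
    (hw : IsPowerSeriesKernel K w) (hpos : ∀ k, 0 < w k) (A : LinearApprox n) {P : Polynomial ℝ}
    (hP : ∀ i, P.eval (A.point i : ℝ) = 0) (x : UnitSym) :
    |P.eval (x : ℝ)| ≤
      √(∑ k ∈ Finset.range (P.natDegree + 1), P.coeff k ^ 2 / w k) * ‖A.errorRepresenter H x‖ := by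
  set e : ℕ → ℝ := fun k => (x : ℝ) ^ k - A.apply (fun y => (y : ℝ) ^ k) x
  have heval : P.eval (x : ℝ) = ∑ k ∈ Finset.range (P.natDegree + 1), P.coeff k * e k := by
    rw [A.sum_coeff_mul_pow_sub_apply_pow P x]
    simp [LinearApprox.apply, hP]
  have herror : ∑ k ∈ Finset.range (P.natDegree + 1), w k * e k ^ 2 ≤
      ‖A.errorRepresenter H x‖ ^ 2 :=
    sum_le_hasSum _ (fun k _ => mul_nonneg (hpos k).le (sq_nonneg _))
      (A.hasSum_norm_errorRepresenter_sq hK hw x)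
  rw [← Real.sqrt_sq (norm_nonneg (A.errorRepresenter H x)), ← Real.sqrt_mul' _ (sq_nonneg _)]
  refine Real.abs_le_sqrt ?_
  calc P.eval (x : ℝ) ^ 2
      ≤ (∑ k ∈ Finset.range (P.natDegree + 1), P.coeff k ^ 2 / w k) *
          ∑ k ∈ Finset.range (P.natDegree + 1), w k * e k ^ 2 := by
        rw [heval]
        refine Finset.sum_sq_le_sum_mul_sum_of_sq_le_mul _
          (fun k _ => div_nonneg (sq_nonneg _) (hpos k).le)
          (fun k _ => mul_nonneg (hpos k).le (sq_nonneg _)) fun k _ => ?_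
        have := (hpos k).ne'
        exact le_of_eq (by field_simp)
    _ ≤ _ := by
        gcongr
        exact Finset.sum_nonneg fun k _ => div_nonneg (sq_nonneg _) (hpos k).le

end PowerSeriesKernel

section BesselWeight

/-- The weight `αₖ⁻¹ = εᵏ / (k!)²` of the Bessel kernel as a power series kernel. -/
noncomputable def besselWeight (ε : ℝ) (k : ℕ) : ℝ :=
  ε ^ k / (k.factorial : ℝ) ^ 2

/-- The total weight `∑ₖ αₖ⁻¹ = I₀(2 √ε)`, the largest value of the Bessel kernel. -/
noncomputable def besselMass (ε : ℝ) : ℝ :=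
  ∑' k, besselWeight ε k

theorem isPowerSeriesKernel_besselKernel (ε : ℝ) :
    IsPowerSeriesKernel (besselKernel ε) (besselWeight ε) := fun x y => by
  rw [besselKernel_eq_tsum]
  refine (summable_bessel ε x y).hasSum.congr_fun fun k => ?_
  rw [besselWeight, inv_pow, mul_inv, inv_inv, div_eq_mul_inv]

theorem hasSum_besselWeight (ε : ℝ) : HasSum (besselWeight ε) (besselMass ε) := by
  have h := isPowerSeriesKernel_besselKernel ε ⟨1, by simp⟩ ⟨1, by simp⟩
  simp only [one_pow, mul_one] at h
  exact h.summable.hasSum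

theorem besselWeight_pos {ε : ℝ} (hε : 0 < ε) (k : ℕ) : 0 < besselWeight ε k := by
  unfold besselWeight
  positivity

theorem besselMass_pos {ε : ℝ} (hε : 0 < ε) : 0 < besselMass ε :=
  (besselWeight_pos hε 0).trans_le
    (le_hasSum (hasSum_besselWeight ε) 0 fun k _ => (besselWeight_pos hε k).le)

theorem sqrt_besselWeight {ε : ℝ} (hε : 0 ≤ ε) (k : ℕ) :
    √(besselWeight ε k) = √ε ^ k / k.factorial := by
  rw [Real.sqrt_eq_iff_eq_sq (by unfold besselWeight; positivity) (by positivity), div_pow,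
    ← pow_mul, mul_comm k 2, pow_mul, Real.sq_sqrt hε, besselWeight]

theorem besselWeight_add_mul_choose_sq (ε : ℝ) (j k : ℕ) :
    besselWeight ε (j + k) * ((j + k).choose k : ℝ) ^ 2 = besselWeight ε j * besselWeight ε k := by
  rw [Nat.cast_choose ℝ (Nat.le_add_left k j), Nat.add_sub_cancel]
  simp only [besselWeight, pow_add]
  field_simp

theorem hasSum_besselWeight_mul_choose_sq (ε : ℝ) (n : ℕ) :
    HasSum (fun k => besselWeight ε k * (k.choose n : ℝ) ^ 2)
      (besselMass ε * besselWeight ε n) := by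
  have hvanish : ∑ k ∈ Finset.range n, besselWeight ε k * (k.choose n : ℝ) ^ 2 = 0 :=
    Finset.sum_eq_zero fun k hk => by simp [Nat.choose_eq_zero_of_lt (Finset.mem_range.1 hk)]
  rw [← add_zero (besselMass ε * _), ← hvanish, ← hasSum_nat_add_iff]
  exact ((hasSum_besselWeight ε).mul_right _).congr_fun
    fun k => besselWeight_add_mul_choose_sq ε k n

theorem sum_choose_sq_div_besselWeight_le {ε : ℝ} (hε : 0 < ε) (n : ℕ) :
    ∑ k ∈ Finset.range (n + 1), (n.choose k : ℝ) ^ 2 / besselWeight ε k ≤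
      besselMass ε / besselWeight ε n := by
  have hterm : ∀ k ∈ Finset.range (n + 1), (n.choose k : ℝ) ^ 2 / besselWeight ε k =
      besselWeight ε (n - k) / besselWeight ε n := fun k hk => by
    have h := besselWeight_add_mul_choose_sq ε (n - k) k
    rw [Nat.sub_add_cancel (Nat.lt_succ_iff.1 (Finset.mem_range.1 hk))] at h
    rw [div_eq_div_iff (besselWeight_pos hε k).ne' (besselWeight_pos hε n).ne', ← h, mul_comm]
  rw [Finset.sum_congr rfl hterm, ← Finset.sum_div, Finset.sum_flip]
  gcongr
  · exact (besselWeight_pos hε n).le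
  · exact sum_le_hasSum _ (fun k _ => (besselWeight_pos hε k).le) (hasSum_besselWeight ε)

end BesselWeight

section BesselError

variable {H : Type*} [NormedAddCommGroup H] [InnerProductSpace ℝ H] [CompleteSpace H]
  [RKHS ℝ H UnitSym ℝ] {ε : ℝ} {n : ℕ}

theorem worstCaseError_lagrangeApprox_le_of_besselKernel (hε : 0 < ε)
    (hK : HasScalarKernel H (besselKernel ε)) (v : Fin n → UnitSym) (hv : Function.Injective v)
    {M : ℝ} (hM : ∀ x : UnitSym, |∏ i, ((x : ℝ) - v i)| ≤ M) :
    worstCaseError H (lagrangeApprox v hv) ≤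
      ENNReal.ofReal (M * (√(besselMass ε) * (√ε ^ n / n.factorial))) := by
  have h := worstCaseError_lagrangeApprox_le hK (isPowerSeriesKernel_besselKernel ε)
    (fun k => (besselWeight_pos hε k).le) (hasSum_besselWeight_mul_choose_sq ε n) v hv hM
  rwa [Real.sqrt_mul (besselMass_pos hε).le, sqrt_besselWeight hε.le] at h

theorem abs_prod_sub_point_le_norm_errorRepresenter (hε : 0 < ε)
    (hK : HasScalarKernel H (besselKernel ε)) (A : LinearApprox n) (x : UnitSym) :
    |∏ i, ((x : ℝ) - A.point i)| ≤
      √(besselMass ε / besselWeight ε n) * ‖A.errorRepresenter H x‖ := by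
  set P := Lagrange.nodal Finset.univ fun i => (A.point i : ℝ) with hP
  have hdeg : P.natDegree = n := by simp [hP, Lagrange.natDegree_nodal]
  have hroot : ∀ i, P.eval (A.point i : ℝ) = 0 := fun i =>
    Lagrange.eval_nodal_at_node (v := fun i => (A.point i : ℝ)) (Finset.mem_univ i)
  have hcoeff : ∀ k, P.coeff k ^ 2 ≤ (n.choose k : ℝ) ^ 2 := fun k => by
    have h := norm_coeff_nodal_le_choose (s := Finset.univ) (v := fun i => (A.point i : ℝ))
      (fun i _ => abs_le.2 (A.point i).2) k
    rw [Finset.card_univ, Fintype.card_fin] at h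
    exact sq_le_sq.2 (h.trans (le_abs_self _))
  rw [← Lagrange.eval_nodal]
  refine (abs_eval_le_of_eval_point_eq_zero hK (isPowerSeriesKernel_besselKernel ε)
    (besselWeight_pos hε) A hroot x).trans ?_
  rw [hdeg]
  gcongr
  refine (Finset.sum_le_sum fun k _ => ?_).trans (sum_choose_sq_div_besselWeight_le hε n)
  exact div_le_div_of_nonneg_right (hcoeff k) (besselWeight_pos hε k).le

theorem ofReal_le_worstCaseError (hε : 0 < ε) (hK : HasScalarKernel H (besselKernel ε))
    (hn : n ≠ 0) (A : LinearApprox n) :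
    ENNReal.ofReal (2 / 2 ^ n / √(besselMass ε) * (√ε ^ n / n.factorial)) ≤
      worstCaseError H A := by
  obtain ⟨x, hx, hlarge⟩ := exists_two_div_two_pow_le_abs_eval
    (P := Lagrange.nodal Finset.univ fun i => (A.point i : ℝ)) Lagrange.nodal_monic
    (by simpa [Lagrange.natDegree_nodal] using hn)
  lift x to UnitSym using hx
  rw [Lagrange.eval_nodal, Lagrange.natDegree_nodal, Finset.card_univ, Fintype.card_fin] at hlarge
  rw [worstCaseError_eq_iSup_norm_errorRepresenter]
  refine le_iSup_of_le x (ENNReal.ofReal_le_ofReal ?_)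
  have h := hlarge.trans (abs_prod_sub_point_le_norm_errorRepresenter hε hK A x)
  have hB := Real.sqrt_pos.2 (besselMass_pos hε)
  have hw := Real.sqrt_pos.2 (besselWeight_pos hε n)
  rw [← sqrt_besselWeight hε.le, div_mul_eq_mul_div, div_le_iff₀' hB, ← le_div_iff₀ hw]
  rwa [Real.sqrt_div (besselMass_pos hε).le, div_mul_eq_mul_div] at h

end BesselError

section BesselMass

theorem besselMass_le_exp_two_mul_sqrt {ε : ℝ} (hε : 0 ≤ ε) :
    besselMass ε ≤ Real.exp (2 * √ε) := by
  have hterm : ∀ k, besselWeight ε k ≤ (2 * √ε) ^ (2 * k) / (2 * k).factorial := fun k => by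
    have hfactorial : ((2 * k).factorial : ℝ) ≤ 4 ^ k * (k.factorial : ℝ) ^ 2 := by
      have h := Nat.choose_mul_factorial_mul_factorial (Nat.le_mul_of_pos_left k two_pos)
      rw [← Nat.centralBinom_eq_two_mul_choose, two_mul, Nat.add_sub_cancel, ← two_mul] at h
      rw [← h, mul_assoc, ← sq]
      push_cast
      gcongr
      exact_mod_cast Nat.centralBinom_le_four_pow k
    rw [besselWeight, pow_mul, mul_pow, Real.sq_sqrt hε, mul_pow,
      div_le_div_iff₀ (by positivity) (by positivity)]
    calc ε ^ k * ((2 * k).factorial : ℝ) ≤ ε ^ k * (4 ^ k * (k.factorial : ℝ) ^ 2) := by gcongr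
      _ = _ := by ring
  calc besselMass ε ≤ Real.cosh (2 * √ε) :=
        hasSum_le hterm (hasSum_besselWeight ε) (Real.hasSum_cosh _)
    _ ≤ Real.exp (2 * √ε) := by
        rw [← Real.cosh_add_sinh]
        exact le_add_of_nonneg_right (Real.sinh_nonneg_iff.2 (by positivity))

theorem two_pow_le_two_mul_factorial (k : ℕ) : 2 ^ k ≤ 2 * k.factorial := by
  cases k with
  | zero => norm_num
  | succ k =>
    have h := Nat.factorial_mul_pow_le_factorial (m := 1) (n := k)
    rw [Nat.factorial_one, one_mul, add_comm 1 k] at h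
    rw [pow_succ']
    exact Nat.mul_le_mul_left 2 h

theorem besselMass_le_two_mul_exp_half {ε : ℝ} (hε : 0 ≤ ε) :
    besselMass ε ≤ 2 * Real.exp (ε / 2) := by
  have hexp : HasSum (fun k : ℕ => (ε / 2) ^ k / (k.factorial : ℝ)) (Real.exp (ε / 2)) := by
    rw [Real.exp_eq_exp_ℝ]
    exact NormedSpace.expSeries_div_hasSum_exp _
  refine hasSum_le (fun k => ?_) (hasSum_besselWeight ε) (hexp.mul_left 2)
  rw [besselWeight, div_pow, div_div, mul_div_assoc',
    div_le_div_iff₀ (by positivity) (by positivity)]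
  calc ε ^ k * (2 ^ k * k.factorial) ≤ ε ^ k * (2 * k.factorial * k.factorial) := by
        gcongr
        exact_mod_cast two_pow_le_two_mul_factorial k
    _ = _ := by ring

theorem exp_half_le_one_add_mul_exp_sq {x : ℝ} (hx : 0 ≤ x) :
    Real.exp (x / 2) ≤ (1 + x) * Real.exp (x ^ 2 / 16) := by
  have hlog : x / 2 ≤ Real.log (1 + x) + x ^ 2 / 16 := by
    refine le_trans ?_ (add_le_add_left (Real.le_log_one_add_of_nonneg hx) _)
    rw [div_add_div _ _ (by positivity) (by norm_num),
      div_le_div_iff₀ (by norm_num) (by positivity)]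
    nlinarith [mul_nonneg hx (sq_nonneg (x - 3))]
  calc Real.exp (x / 2) ≤ Real.exp (Real.log (1 + x) + x ^ 2 / 16) := Real.exp_le_exp.2 hlog
    _ = (1 + x) * Real.exp (x ^ 2 / 16) := by rw [Real.exp_add, Real.exp_log (by positivity)]

theorem sqrt_mul_exp_le_two_div_sqrt_besselMass {ε : ℝ} (hε : 0 < ε) :
    √(2 / (1 + ε)) * Real.exp (-(1 / 32) * ε ^ 2) ≤ 2 / √(besselMass ε) := by
  have hexp : Real.exp (-(1 / 32) * ε ^ 2) ^ 2 * Real.exp (ε ^ 2 / 16) = 1 := by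
    rw [← Real.exp_nat_mul, ← Real.exp_add, Real.exp_eq_one_iff]
    push_cast
    ring
  rw [le_div_iff₀ (Real.sqrt_pos.2 (besselMass_pos hε))]
  refine le_of_sq_le_sq ?_ two_pos.le
  rw [mul_pow, mul_pow, Real.sq_sqrt (by positivity), Real.sq_sqrt (besselMass_pos hε).le]
  calc 2 / (1 + ε) * Real.exp (-(1 / 32) * ε ^ 2) ^ 2 * besselMass ε
      ≤ 2 / (1 + ε) * Real.exp (-(1 / 32) * ε ^ 2) ^ 2 *
          (2 * ((1 + ε) * Real.exp (ε ^ 2 / 16))) := by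
        gcongr
        exact (besselMass_le_two_mul_exp_half hε.le).trans
          (by gcongr; exact exp_half_le_one_add_mul_exp_sq hε.le)
    _ = 4 * (Real.exp (-(1 / 32) * ε ^ 2) ^ 2 * Real.exp (ε ^ 2 / 16)) := by
        field_simp
        norm_num
    _ = 2 ^ 2 := by rw [hexp]; norm_num

theorem cL_nonneg {l : ℝ} (hl : 0 ≤ l) : 0 ≤ cL l := by
  unfold cL
  positivity

theorem three_div_four_mul_exp_div_rpow_le_cL {l : ℝ} (hl : 0 < l) :
    3 / 4 * (Real.exp (-(3 / 2) * l + 2 * √l) / l ^ (1 / 4 : ℝ)) ≤ cL l := by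
  have hpi : √Real.pi ≤ 2 := Real.sqrt_le_iff.2 ⟨by norm_num, by linarith [Real.pi_le_four]⟩
  have hsum : 3 ≤ 3 + √(Real.pi / Real.exp 1) + 2 / (√Real.pi * l ^ (1 / 4 : ℝ)) + 7 / (16 * √l)
      + √l * (2 + l) := by
    simp only [add_assoc]
    exact le_add_of_nonneg_right (by positivity)
  calc 3 / 4 * (Real.exp (-(3 / 2) * l + 2 * √l) / l ^ (1 / 4 : ℝ))
      = Real.exp (-(3 / 2) * l + 2 * √l) / (2 * 2 * l ^ (1 / 4 : ℝ)) * 3 := by ring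
    _ ≤ cL l := by
      unfold cL
      gcongr

theorem besselMass_le_cL_mul {ε x : ℝ} (hε : 0 < ε) (hx : ε ≤ x) :
    besselMass ε ≤ cL ε * x ^ (-(1 / 4) : ℝ) * Real.exp (2 * √(ε * x)) := by
  have hx0 : 0 < x := hε.trans_le hx
  set t := √(ε * x)
  have ht : ε ≤ t := Real.le_sqrt_of_sq_le (by nlinarith)
  have hroot : ε ^ (1 / 4 : ℝ) * x ^ (1 / 4 : ℝ) = √t := by
    rw [← Real.mul_rpow hε.le hx0.le, Real.sqrt_eq_rpow, show t = _ from Real.sqrt_eq_rpow _,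
      ← Real.rpow_mul (by positivity)]
    norm_num
  have hexp : 4 / 3 * √t ≤ Real.exp (2 * t - 3 / 2 * ε) := by
    have h := Real.add_one_le_exp (2 * t - 3 / 2 * ε)
    nlinarith [sq_nonneg (√t - 4 / 3), Real.sq_sqrt (hε.le.trans ht)]
  calc besselMass ε ≤ Real.exp (2 * √ε) := besselMass_le_exp_two_mul_sqrt hε.le
    _ = 3 / 4 * (Real.exp (-(3 / 2) * ε + 2 * √ε) / ε ^ (1 / 4 : ℝ)) * x ^ (-(1 / 4) : ℝ) *
          (4 / 3 * √t * Real.exp (3 / 2 * ε)) := by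
        rw [← hroot, Real.rpow_neg hx0.le, Real.exp_add, neg_mul, Real.exp_neg]
        field_simp
    _ ≤ cL ε * x ^ (-(1 / 4) : ℝ) * (Real.exp (2 * t - 3 / 2 * ε) * Real.exp (3 / 2 * ε)) := by
        have hcL := cL_nonneg hε.le
        gcongr
        exact three_div_four_mul_exp_div_rpow_le_cL hε
    _ = cL ε * x ^ (-(1 / 4) : ℝ) * Real.exp (2 * t) := by rw [← Real.exp_add, sub_add_cancel]

theorem sqrt_besselMass_le_sqrt_cL_mul {ε x : ℝ} (hε : 0 < ε) (hx : ε ≤ x) :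
    √(besselMass ε) ≤ √(cL ε) * x ^ (-(1 / 8) : ℝ) * Real.exp √(ε * x) := by
  have hx0 : 0 < x := hε.trans_le hx
  rw [Real.sqrt_le_left (by positivity), mul_pow, mul_pow, Real.sq_sqrt (cL_nonneg hε.le),
    ← Real.exp_nat_mul, ← Real.rpow_mul_natCast hx0.le]
  have h := besselMass_le_cL_mul hε hx
  norm_num at h ⊢
  exact h

end BesselMass

section MainTheorem

theorem abs_prod_sub_le_two_pow {n : ℕ} (v : Fin n → UnitSym) (x : UnitSym) :
    |∏ i, ((x : ℝ) - v i)| ≤ 2 ^ n := by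
  rw [Finset.abs_prod]
  calc ∏ i, |(x : ℝ) - v i| ≤ ∏ _i : Fin n, (2 : ℝ) := by
        gcongr with i
        exact (abs_sub_le_of_le_of_le x.2.1 x.2.2 (v i).2.1 (v i).2.2).trans_eq (by norm_num)
    _ = 2 ^ n := by simp

theorem worstCaseError_lagrangeApprox_le_sqrt_cL_mul {ε : ℝ} (hε : 0 < ε)
    {H : Type*} [NormedAddCommGroup H] [InnerProductSpace ℝ H] [CompleteSpace H]
    [RKHS ℝ H UnitSym ℝ] (hK : HasScalarKernel H (besselKernel ε)) {n : ℕ} (hn : ε ≤ n)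
    (v : Fin n → UnitSym) (hv : Function.Injective v) {M : ℝ}
    (hM : ∀ x : UnitSym, |∏ i, ((x : ℝ) - v i)| ≤ M) :
    worstCaseError H (lagrangeApprox v hv) ≤ ENNReal.ofReal
      (M * (√(cL ε) * (n : ℝ) ^ (-(1 / 8) : ℝ) * Real.exp √(ε * n) * (√ε ^ n / n.factorial))) := by
  have hM0 : 0 ≤ M := (abs_nonneg _).trans (hM ⟨0, by simp⟩)
  refine (worstCaseError_lagrangeApprox_le_of_besselKernel hε hK v hv hM).trans
    (ENNReal.ofReal_le_ofReal ?_)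
  gcongr
  exact sqrt_besselMass_le_sqrt_cL_mul hε hn

theorem mainTheorem9_general (ε : ℝ) (hε : 0 < ε)
    (H : Type*) [NormedAddCommGroup H] [InnerProductSpace ℝ H] [CompleteSpace H]
    [RKHS ℝ H UnitSym ℝ] (hK : HasScalarKernel H (besselKernel ε))
    (c₁ c₂ : ℝ) (hc₁ : c₁ = √(2 / (1 + ε)) * Real.exp (-(1 / 32) * ε ^ 2))
    (hc₂ : c₂ = 2 * √(cL ε))
    (n : ℕ) (hn : ε ≤ n) :
    (ENNReal.ofReal (c₁ * (√ε / 2) ^ n * (n.factorial : ℝ)⁻¹) ≤ minimalError H n ∧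
      minimalError H n ≤
        ENNReal.ofReal (c₂ * (n : ℝ) ^ (-(1 / 8) : ℝ) * Real.exp √(ε * n) * (√ε / 2) ^ n *
          (n.factorial : ℝ)⁻¹)) ∧
    ∀ x : Fin n → UnitSym, Function.Injective x →
      ∃ A : LinearApprox n, A.point = x ∧
        ENNReal.ofReal (c₁ * (√ε / 2) ^ n * (n.factorial : ℝ)⁻¹) ≤ worstCaseError H A ∧
        worstCaseError H A ≤
          ENNReal.ofReal (c₂ / 2 * (n : ℝ) ^ (-(1 / 8) : ℝ) * Real.exp √(ε * n) *
            (2 * √ε) ^ n * (n.factorial : ℝ)⁻¹) := by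
  have hn0 : n ≠ 0 := by exact_mod_cast (hε.trans_le hn).ne'
  have hlower (A : LinearApprox n) :
      ENNReal.ofReal (c₁ * (√ε / 2) ^ n * (n.factorial : ℝ)⁻¹) ≤ worstCaseError H A := by
    refine (ENNReal.ofReal_le_ofReal ?_).trans (ofReal_le_worstCaseError hε hK hn0 A)
    calc c₁ * (√ε / 2) ^ n * (n.factorial : ℝ)⁻¹
        ≤ 2 / √(besselMass ε) * (√ε / 2) ^ n * (n.factorial : ℝ)⁻¹ := by
          gcongr
          exact hc₁ ▸ sqrt_mul_exp_le_two_div_sqrt_besselMass hε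
      _ = _ := by rw [div_pow]; ring
  refine ⟨⟨le_iInf hlower, ?_⟩, fun x hx => ⟨lagrangeApprox x hx, rfl, hlower _, ?_⟩⟩
  · obtain ⟨v, hv, hnodes⟩ := exists_chebyshev_nodes hn0
    refine (iInf_le _ (lagrangeApprox v hv)).trans
      ((worstCaseError_lagrangeApprox_le_sqrt_cL_mul hε hK hn v hv hnodes).trans_eq ?_)
    rw [hc₂, div_pow]
    ring_nf
  · refine (worstCaseError_lagrangeApprox_le_sqrt_cL_mul hε hK hn x hx
      (abs_prod_sub_le_two_pow x)).trans_eq ?_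
    rw [hc₂, mul_pow]
    ring_nf

end MainTheorem

theorem mainTheorem9 (ε : ℝ) (hε : 0 < ε)
    (H : Type*) [NormedAddCommGroup H] [InnerProductSpace ℝ H] [CompleteSpace H]
    [RKHS ℝ H UnitSym ℝ] (hK : HasScalarKernel H (besselKernel ε))
    (c₁ c₂ : ℝ) (hc₁ : c₁ = √(2 / (1 + ε)) * Real.exp (-(1 / 32) * ε ^ 2))
    (hc₂ : c₂ = 2 * √(cL ε))
    (n : ℕ) (hn : mL ε ≤ n) :
    (ENNReal.ofReal (c₁ * (√ε / 2) ^ n * (n.factorial : ℝ)⁻¹) ≤ minimalError H n ∧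
      minimalError H n ≤
        ENNReal.ofReal (c₂ * (n : ℝ) ^ (-(1 / 8) : ℝ) * Real.exp √(ε * n) * (√ε / 2) ^ n *
          (n.factorial : ℝ)⁻¹)) ∧
    ∀ x : Fin n → UnitSym, Function.Injective x →
      ∃ A : LinearApprox n, A.point = x ∧
        ENNReal.ofReal (c₁ * (√ε / 2) ^ n * (n.factorial : ℝ)⁻¹) ≤ worstCaseError H A ∧
        worstCaseError H A ≤
          ENNReal.ofReal (c₂ / 2 * (n : ℝ) ^ (-(1 / 8) : ℝ) * Real.exp √(ε * n) *
            (2 * √ε) ^ n * (n.factorial : ℝ)⁻¹) :=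
  mainTheorem9_general ε hε H hK c₁ c₂ hc₁ hc₂ n <|
    ((by linarith : ε ≤ 5 * ε).trans ((le_max_left _ _).trans (le_max_left _ _))).trans hn
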